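/- Digraphs are finite and may have multiple arcs but no loops. An $r$-arborescence is a digraph whose underlying undirected graph is a tree and in which, for every vertex $u$, there is exactly one directed path from $r$ to $u$; $r$ is its root. A branching $B$ of a digraph $D$ is a spanning subdigraph of $D$ each component of which is an arborescence; its root set $R(B)$ consists of the roots of its components, and its size is its number of arcs. A decomposition of $D$ into $k$ branchings is a family of $k$ pairwise arc-disjoint branchings $B_1,\dots,B_k$ of $D$ (possibly without arcs) that together contain all arcs of $D$. Let $\Delta^-(D)$ be the maximum in-degree of $D$, and let $$\gamma(D)=\max_{H}\frac{|E(H)|}{|V(H)|-1}$$ be its fractional arboricity, where $H$ runs over the subgraphs of the underlying graph of $D$ with $|V(H)|\ge 2$ ($\gamma(D)=0$ if there is none). Let $D=(V,A)$ be a digraph and $k\ge 1$ an integer. (1) If $A$ can be covered by $k$ branchings, then $A$ can be covered by $k$ branchings each of size $\lfloor |A|/k\rfloor$ or $\lceil |A|/k\rceil$. (2) (Equivalent form.) If $\Delta^-(D)\le k$ and $\gamma(D)\le k$, and $c=k|V|-|A|$, then $D$ can be decomposed into $k$ branchings $B_1,\dots,B_k$ such that, for each $i$, $|R(B_i)|=\lfloor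 c/k\rfloor$ or $|R(B_i)|=\lceil c/k\rceil$. -/

import Mathlib

/-- A loopless digraph with vertex set `V` and arc set `E`; multiple arcs are allowed. -/
structure MultiDigraph (V : Type*) (E : Type*) where
  /-- the tail of an arc -/
  tail : E → V
  /-- the head of an arc -/
  head : E → V
  /-- there are no loops -/
  tail_ne_head : ∀ e, tail e ≠ head e

namespace MultiDigraph

variable {V : Type*} {E : Type*}

/-- A subdigraph (not necessarily spanning, not necessarily induced): a set of vertices and a set
of arcs whose ends are among these vertices. -/
@[ext] structure Subdigraph (D : MultiDigraph V E) where
  /-- the vertices -/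
  verts : Set V
  /-- the arcs -/
  arcs : Set E
  /-- tails of arcs are vertices -/
  tail_mem : ∀ e ∈ arcs, D.tail e ∈ verts
  /-- heads of arcs are vertices -/
  head_mem : ∀ e ∈ arcs, D.head e ∈ verts

/-- The first vertex of a traversal of an arc. The pair `(e, true)` stands for the arc `e`
traversed forwards, from tail to head, and `(e, false)` for `e` traversed backwards. -/
def source (D : MultiDigraph V E) (d : E × Bool) : V :=
  if d.2 then D.tail d.1 else D.head d.1

/-- The last vertex of a traversal of an arc. -/
def target (D : MultiDigraph V E) (d : E × Bool) : V :=
  if d.2 then D.head d.1 else D.tail d.1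

namespace Subdigraph

variable {D : MultiDigraph V E}

/-- `H.IsWalk u l v`: the list `l` of traversals of arcs of `H` is a walk from `u` to `v` in the
underlying undirected graph of `H`. -/
def IsWalk (H : D.Subdigraph) : V → List (E × Bool) → V → Prop
  | u, [], v => u ∈ H.verts ∧ u = v
  | u, d :: l, v => d.1 ∈ H.arcs ∧ D.source d = u ∧ H.IsWalk (D.target d) l v

/-- A directed path of `H` from `u` to `v`: a walk that traverses every arc forwards and visits no
vertex twice. -/
def IsDirectedPath (H : D.Subdigraph) (u : V) (l : List (E × Bool)) (v : V) : Prop :=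
  H.IsWalk u l v ∧ (∀ d ∈ l, d.2 = true) ∧ (u :: l.map D.target).Nodup

/-- `l` traverses a cycle through `u` of the underlying undirected graph of `H`: a closed walk
of positive length without repeated arcs and without repeated vertices (apart from its first vertex
being its last one). Two parallel or antiparallel arcs form a cycle of length two. -/
def IsCycle (H : D.Subdigraph) (u : V) (l : List (E × Bool)) : Prop :=
  H.IsWalk u l u ∧ l ≠ [] ∧ (l.map Prod.fst).Nodup ∧ (l.map D.target).Nodup

/-- Two vertices are joined by a walk in the underlying undirected graph of `H`. -/
def Reachable (H : D.Subdigraph) (u v : V) : Prop :=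
  ∃ l, H.IsWalk u l v

/-- The underlying undirected graph of `H` is a tree: it is non-empty, connected and acyclic. -/
def IsTree (H : D.Subdigraph) : Prop :=
  H.verts.Nonempty ∧ (∀ u ∈ H.verts, ∀ v ∈ H.verts, H.Reachable u v) ∧ ∀ u l, ¬ H.IsCycle u l

/-- `H` is an `r`-arborescence. -/
def IsArborescence (H : D.Subdigraph) (r : V) : Prop :=
  H.IsTree ∧ r ∈ H.verts ∧ ∀ u ∈ H.verts, ∃! l, H.IsDirectedPath r l u

/-- The (weakly) connected component of `H` that contains the vertex `v`. -/
def component (H : D.Subdigraph) (v : V) : D.Subdigraph where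
  verts := {u | u ∈ H.verts ∧ H.Reachable v u}
  arcs := {e | e ∈ H.arcs ∧ H.Reachable v (D.tail e) ∧ H.Reachable v (D.head e)}
  tail_mem := fun e he => ⟨H.tail_mem e he.1, he.2.1⟩
  head_mem := fun e he => ⟨H.head_mem e he.1, he.2.2⟩

/-- A branching: a spanning subdigraph each component of which is an arborescence. -/
def IsBranching (B : D.Subdigraph) : Prop :=
  B.verts = Set.univ ∧ ∀ v ∈ B.verts, ∃ r, (B.component v).IsArborescence r

/-- The root set: all roots of the components. -/
def rootSet (B : D.Subdigraph) : Set V :=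
  {r | ∃ v ∈ B.verts, (B.component v).IsArborescence r}

/-- The size of a subdigraph is its number of arcs. -/
noncomputable def size (B : D.Subdigraph) : ℕ := B.arcs.ncard

end Subdigraph

/-- The arcs are covered by the `k` branchings `B 0, …, B (k - 1)` (which may share arcs). -/
def IsBranchingCover (D : MultiDigraph V E) {k : ℕ} (B : Fin k → D.Subdigraph) : Prop :=
  (∀ i, (B i).IsBranching) ∧ ∀ e : E, ∃ i, e ∈ (B i).arcs

/-- `D` is decomposed into the `k` branchings `B 0, …, B (k - 1)`: they are pairwise arc-disjoint
and cover all arcs. -/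
def IsBranchingDecomposition (D : MultiDigraph V E) {k : ℕ} (B : Fin k → D.Subdigraph) : Prop :=
  D.IsBranchingCover B ∧ ∀ i j, i ≠ j → Disjoint (B i).arcs (B j).arcs

/-- The in-degree of a vertex. -/
noncomputable def inDegree (D : MultiDigraph V E) (v : V) : ℕ := {e | D.head e = v}.ncard

/-- The maximum in-degree (`0` if there is no vertex). -/
noncomputable def maxInDegree (D : MultiDigraph V E) : ℕ := ⨆ v, D.inDegree v

/-- The fractional arboricity: the maximum of `|E(H)| / (|V(H)| - 1)` over all subgraphs `H` with
at least two vertices (`0` if there are fewer than two vertices). -/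
noncomputable def fractionalArboricity (D : MultiDigraph V E) : ℝ :=
  sSup {q | ∃ H : D.Subdigraph, 2 ≤ H.verts.ncard ∧
    q = (H.arcs.ncard : ℝ) / ((H.verts.ncard : ℝ) - 1)}

end MultiDigraph

/-!
The arc sets of branchings are the *diforests*, and the roots of a branching are the vertices which
are not heads of its arcs. Hence only the colourings of the arcs by `k` diforests matter, and all
colour classes have to be made equally large up to one arc.

Edmonds' theorem says when an arc set contains disjoint diforests with prescribed sets of heads.
Applied to the digraph with an additional root which is joined to each vertex until all in-degrees
are `k`, it gives Frank's theorem: if every in-degree is at most `k` and every non-empty vertex set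
`U` spans at most `k (|U| - 1)` arcs, then a colouring exists.

To balance a colouring, let `B` and `C` be two classes with `|B| < |C|`. Some vertex `v` can be
moved from the heads of `C` to those of `B` without violating the condition of Edmonds' theorem in
`B ∪ C`. Otherwise each head `v` of `C` only lies in a set `U v` of `v` and heads of `B` which no
arc of `B ∪ C` enters. Since `C` does not enter `U v`, this set contains some `w v` which is not a
head of `C`. Since `B` must enter any non-empty set of its heads, such as `U v ∩ U v'` if
`w v = w v'`, the map `w` is injective, which contradicts `|B| < |C|`. Such a transfer decreases the
sum of the squares of the sizes unless `|C| = |B| + 1`.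
-/

namespace MultiDigraph

open Finset

variable {V E ι : Type*} {D : MultiDigraph V E}

/-- `B` is a diforest, that is, the arc set of a branching: no two of its arcs share their head, and
some rank function increases along each of them (which excludes directed cycles). -/
def IsDiforest (D : MultiDigraph V E) (B : Set E) : Prop :=
  Set.InjOn D.head B ∧ ∃ rank : V → ℕ, ∀ e ∈ B, rank (D.tail e) < rank (D.head e)

namespace IsDiforest

theorem mono {B C : Set E} (hC : D.IsDiforest C) (hBC : B ⊆ C) : D.IsDiforest B :=
  ⟨hC.1.mono hBC, hC.2.imp fun _ hr e he => hr e (hBC he)⟩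

theorem empty : D.IsDiforest ∅ :=
  ⟨Set.injOn_empty _, 0, fun _ he => he.elim⟩

theorem insert_of_notMem_heads {B : Set E} {e : E} (hB : D.IsDiforest B)
    (htail : D.tail e ∉ D.head '' B) (hhead : D.head e ∉ D.head '' B) :
    D.IsDiforest (insert e B) := by
  classical
  obtain ⟨hinj, rank, hrank⟩ := hB
  refine ⟨(Set.injOn_insert fun he => hhead ⟨e, he, rfl⟩).2 ⟨hinj, hhead⟩,
    fun v => if v ∈ D.head '' B then rank v + 2 else if v = D.head e then 1 else 0, ?_⟩
  rintro f (rfl | hf)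
  · simp only [htail, hhead, D.tail_ne_head f, if_false, if_true, zero_lt_one]
  · have := hrank f hf
    simp only [Set.mem_image_of_mem D.head hf, if_true]
    split_ifs <;> omega

theorem card_image_head [DecidableEq V] {B : Finset E} (hB : D.IsDiforest (B : Set E)) :
    #(B.image D.head) = #B :=
  card_image_of_injOn hB.1

end IsDiforest

/-! ### Disjoint diforests with prescribed heads -/

section Edmonds

variable [DecidableEq V]

/-- The arcs of `A` that enter the vertex set `U`. -/
def enteringArcs (D : MultiDigraph V E) (A : Finset E) (U : Finset V) : Finset E :=
  {e ∈ A | D.head e ∈ U ∧ D.tail e ∉ U}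

theorem mem_enteringArcs {A : Finset E} {U : Finset V} {e : E} :
    e ∈ D.enteringArcs A U ↔ e ∈ A ∧ D.head e ∈ U ∧ D.tail e ∉ U :=
  mem_filter

theorem enteringArcs_mono {A B : Finset E} (hAB : A ⊆ B) (U : Finset V) :
    D.enteringArcs A U ⊆ D.enteringArcs B U :=
  filter_subset_filter _ hAB

theorem enteringArcs_erase [DecidableEq E] (A : Finset E) (e : E) (U : Finset V) :
    D.enteringArcs (A.erase e) U = (D.enteringArcs A U).erase e :=
  filter_erase _ _ _

theorem card_enteringArcs_inter_add_card_enteringArcs_union_le (A : Finset E) (U X : Finset V) :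
    #(D.enteringArcs A (U ∩ X)) + #(D.enteringArcs A (U ∪ X)) ≤
      #(D.enteringArcs A U) + #(D.enteringArcs A X) := by
  simp only [enteringArcs, card_filter, ← sum_add_distrib, mem_inter, mem_union]
  refine sum_le_sum fun e _ => ?_
  split_ifs <;> first | omega | tauto

theorem card_filter_subset_add_card_filter_subset_le (R : ι → Finset V) (I : Finset ι)
    (U X : Finset V) :
    #{j ∈ I | U ⊆ R j} + #{j ∈ I | X ⊆ R j} ≤
      #{j ∈ I | U ∩ X ⊆ R j} + #{j ∈ I | U ∪ X ⊆ R j} := by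
  simp only [card_filter, ← sum_add_distrib, union_subset_iff]
  refine sum_le_sum fun j _ => ?_
  have hU : U ⊆ R j → U ∩ X ⊆ R j := inter_subset_left.trans
  have hX : X ⊆ R j → U ∩ X ⊆ R j := inter_subset_right.trans
  split_ifs <;> first | omega | tauto

theorem IsDiforest.enteringArcs_nonempty {B : Finset E} {U : Finset V}
    (hB : D.IsDiforest (B : Set E)) (hU : U.Nonempty) (hUB : U ⊆ B.image D.head) :
    (D.enteringArcs B U).Nonempty := by
  obtain ⟨rank, hrank⟩ := hB.2
  obtain ⟨v, hv, hmin⟩ := exists_min_image U rank hU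
  obtain ⟨e, he, rfl⟩ := mem_image.1 (hUB hv)
  exact ⟨e, mem_enteringArcs.2 ⟨he, hv, fun htail => (hmin _ htail).not_gt (hrank e he)⟩⟩

variable [Fintype ι] {A : Finset E} {R : ι → Finset V}

/-- Edmonds' condition for `A` to contain disjoint diforests whose sets of heads are the `R i`:
each non-empty vertex set is entered by at least as many arcs as there are `R i` containing it. -/
def CutCondition (D : MultiDigraph V E) (A : Finset E) (R : ι → Finset V) : Prop :=
  ∀ U : Finset V, U.Nonempty → #{i | U ⊆ R i} ≤ #(D.enteringArcs A U)

theorem cutCondition_of_disjoint_diforests {B : ι → Finset E} (hBA : ∀ i, B i ⊆ A)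
    (hdisj : Pairwise fun i j => Disjoint (B i) (B j)) (hB : ∀ i, D.IsDiforest (B i : Set E)) :
    D.CutCondition A fun i => (B i).image D.head := by
  intro U hU
  have hentering : ∀ i ∈ ({i | U ⊆ (B i).image D.head} : Finset ι),
      (D.enteringArcs (B i) U).Nonempty := fun i hi =>
    (hB i).enteringArcs_nonempty hU (mem_filter.1 hi).2
  classical
  calc #{i | U ⊆ (B i).image D.head}
      ≤ #(({i | U ⊆ (B i).image D.head} : Finset ι).biUnion fun i => D.enteringArcs (B i) U) :=
        card_le_card_biUnion (fun i _ j _ hij =>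
          (hdisj hij).mono (filter_subset _ _) (filter_subset _ _)) hentering
    _ ≤ #(D.enteringArcs A U) :=
        card_le_card (biUnion_subset.2 fun i _ => enteringArcs_mono (hBA i) U)

section Augmentation

variable [DecidableEq ι] {i : ι} {U : Finset V} {e : E}

/-- A set which meets `R i` and all of whose entering arcs are needed for the sets other than
`R i`. An arc entering such a set must not be given to the `i`-th diforest. -/
def IsTight (D : MultiDigraph V E) (A : Finset E) (R : ι → Finset V) (i : ι) (U : Finset V) :
    Prop :=
  (U ∩ R i).Nonempty ∧ #(D.enteringArcs A U) ≤ #{j ∈ univ.erase i | U ⊆ R j}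

theorem exists_isTight (A : Finset E) (hi : (R i).Nonempty) : ∃ U, D.IsTight A R i U := by
  refine ⟨A.image D.tail ∪ R i, by simpa only [union_inter_cancel_right], ?_⟩
  have hclosed : D.enteringArcs A (A.image D.tail ∪ R i) = ∅ :=
    filter_eq_empty_iff.2 fun e he h => h.2 (mem_union_left _ (mem_image_of_mem _ he))
  simp only [hclosed, card_empty, zero_le]

theorem IsTight.exists_arc (hU : D.IsTight A R i U) (hR : D.CutCondition A R) :
    ∃ e ∈ A, D.head e ∈ U ∩ R i ∧ D.tail e ∈ U \ R i := by
  have hsub : #{j ∈ univ.erase i | U ⊆ R j} < #{j | U ∩ R i ⊆ R j} := by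
    refine card_lt_card (ssubset_iff_of_subset ?_ |>.2 ⟨i, by simp, by simp⟩)
    intro j hj
    exact mem_filter.2 ⟨mem_univ j, inter_subset_left.trans (mem_filter.1 hj).2⟩
  obtain ⟨e, he, heU⟩ := exists_mem_notMem_of_card_lt_card
    (hU.2.trans_lt (hsub.trans_le (hR _ hU.1)))
  simp only [mem_enteringArcs, mem_inter, mem_sdiff] at he heU ⊢
  tauto

theorem card_filter_subset_update_erase_le (R : ι → Finset V) (i : ι) (v : V) (X : Finset V) :
    #{j | X ⊆ Function.update R i ((R i).erase v) j} ≤ #{j | X ⊆ R j} := by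
  refine card_le_card (monotone_filter_right _ fun j _ hj => hj.trans ?_)
  rcases eq_or_ne j i with rfl | hji
  · simpa only [Function.update_self] using erase_subset v (R j)
  · rw [Function.update_of_ne hji]

theorem filter_subset_update_erase_of_mem {v : V} {X : Finset V} (hv : v ∈ X) :
    ({j | X ⊆ Function.update R i ((R i).erase v) j} : Finset ι) =
      {j ∈ univ.erase i | X ⊆ R j} := by
  ext j
  rcases eq_or_ne j i with rfl | hji
  · simp [subset_erase, hv]
  · simp [hji]

/-- Uncrossing: the arcs entering `U` and `X` are counted at least as often in `U ∩ X` and `U ∪ X`,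
so that a tight `X` entered by `e` would make the smaller set `U ∩ X` tight. -/
theorem CutCondition.lt_card_enteringArcs {X : Finset V} (hR : D.CutCondition A R)
    (hU : Minimal (D.IsTight A R i) U) (hhead : D.head e ∈ U ∩ R i) (htail : D.tail e ∈ U)
    (hheadX : D.head e ∈ X) (htailX : D.tail e ∉ X) :
    #{j ∈ univ.erase i | X ⊆ R j} < #(D.enteringArcs A X) := by
  rw [mem_inter] at hhead
  by_contra! hX
  have hnot : ¬ D.IsTight A R i (U ∩ X) := fun h =>
    htailX (mem_inter.1 (hU.le_of_le h inter_subset_left htail)).2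
  have hinter : #{j ∈ univ.erase i | U ∩ X ⊆ R j} < #(D.enteringArcs A (U ∩ X)) := by
    by_contra! h
    exact hnot ⟨⟨D.head e, by simp [hhead, hheadX]⟩, h⟩
  have hunion : #{j ∈ univ.erase i | U ∪ X ⊆ R j} ≤ #(D.enteringArcs A (U ∪ X)) :=
    (card_le_card (filter_subset_filter _ (erase_subset i univ))).trans
      (hR _ ⟨_, mem_union_left X htail⟩)
  have hsub := card_enteringArcs_inter_add_card_enteringArcs_union_le (D := D) A U X
  have hsuper := card_filter_subset_add_card_filter_subset_le R (univ.erase i) U X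
  have htight := hU.prop.2
  omega

theorem CutCondition.exists_erase [DecidableEq E] (hR : D.CutCondition A R) (hi : (R i).Nonempty) :
    ∃ e ∈ A, D.head e ∈ R i ∧ D.tail e ∉ R i ∧
      D.CutCondition (A.erase e) (Function.update R i ((R i).erase (D.head e))) := by
  obtain ⟨U, hU⟩ := exists_minimal_of_wellFoundedLT _ (exists_isTight (D := D) A hi)
  obtain ⟨e, heA, hhead, htail⟩ := hU.prop.exists_arc hR
  rw [mem_sdiff] at htail
  refine ⟨e, heA, (mem_inter.1 hhead).2, htail.2, fun X hX => ?_⟩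
  rw [enteringArcs_erase]
  by_cases heX : e ∈ D.enteringArcs A X
  · obtain ⟨-, hheadX, htailX⟩ := mem_enteringArcs.1 heX
    rw [card_erase_of_mem heX, filter_subset_update_erase_of_mem hheadX]
    exact Nat.le_sub_one_of_lt (hR.lt_card_enteringArcs hU hhead htail.1 hheadX htailX)
  · rw [erase_eq_of_notMem heX]
    exact (card_filter_subset_update_erase_le R i _ X).trans (hR X hX)

end Augmentation

/-- **Edmonds' disjoint branchings theorem.** -/
theorem CutCondition.exists_disjoint_diforests (hR : D.CutCondition A R) :
    ∃ B : ι → Finset E, (∀ i, B i ⊆ A) ∧ (Pairwise fun i j => Disjoint (B i) (B j)) ∧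
      ∀ i, D.IsDiforest (B i : Set E) ∧ (B i).image D.head = R i := by
  classical
  induction A using Finset.strongInduction generalizing R with
  | H A ih =>
  by_cases hempty : ∀ i, R i = ∅
  · exact ⟨fun _ => ∅, fun _ => empty_subset A, fun _ _ _ => disjoint_empty_left _, fun i =>
      ⟨by simpa only [coe_empty] using IsDiforest.empty, by rw [image_empty, hempty i]⟩⟩
  push Not at hempty
  obtain ⟨i, hi⟩ := hempty
  obtain ⟨e, heA, hhead, htail, hR'⟩ := hR.exists_erase hi
  obtain ⟨B, hBA, hdisj, hB⟩ := ih _ (erase_ssubset heA) hR'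
  have heB : ∀ j, e ∉ B j := fun j he => notMem_erase e A (hBA j he)
  have hBA' : ∀ j, B j ⊆ A := fun j => (hBA j).trans (erase_subset e A)
  obtain ⟨hBi, hheads⟩ := hB i
  rw [Function.update_self] at hheads
  have hcoe : D.head '' (B i : Set E) = (R i).erase (D.head e) := by rw [← hheads, coe_image]
  refine ⟨Function.update B i (insert e (B i)), fun j => ?_, fun j l hjl => ?_, fun j => ?_⟩
  · rcases eq_or_ne j i with rfl | hji
    · simpa only [Function.update_self] using insert_subset heA (hBA' j)
    · simpa only [Function.update_of_ne hji] using hBA' j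
  · have := hdisj hjl
    simp only [Function.update_apply]
    split_ifs with hj hl hl
    · exact absurd (hj.trans hl.symm) hjl
    · exact disjoint_insert_left.2 ⟨heB l, hj ▸ this⟩
    · exact disjoint_insert_right.2 ⟨heB j, hl ▸ this⟩
    · exact this
  · rcases eq_or_ne j i with rfl | hji
    · rw [Function.update_self, coe_insert, image_insert, hheads, insert_erase hhead]
      exact ⟨hBi.insert_of_notMem_heads (by simp [hcoe, htail]) (by simp [hcoe]), rfl⟩
    · simpa only [Function.update_of_ne hji] using hB j

theorem CutCondition.exists_diforest_partition [DecidableEq E] (hR : D.CutCondition A R)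
    (hcard : #A ≤ ∑ i, #(R i)) :
    ∃ B : ι → Finset E, (Pairwise fun i j => Disjoint (B i) (B j)) ∧ univ.biUnion B = A ∧
      ∀ i, D.IsDiforest (B i : Set E) ∧ (B i).image D.head = R i := by
  obtain ⟨B, hBA, hdisj, hB⟩ := hR.exists_disjoint_diforests
  refine ⟨B, hdisj, eq_of_subset_of_card_le (biUnion_subset.2 fun i _ => hBA i) ?_, hB⟩
  rw [card_biUnion fun i _ j _ hij => hdisj hij]
  exact hcard.trans_eq (sum_congr rfl fun i _ => by rw [← (hB i).2, (hB i).1.card_image_head])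

end Edmonds

/-! ### Balancing a colouring by diforests -/

section Exchange

variable [DecidableEq E] {B C : Finset E}

section

variable [DecidableEq V]

theorem exists_head_movable (hB : D.IsDiforest (B : Set E)) (hC : D.IsDiforest (C : Set E))
    (hcard : #B < #C) :
    ∃ v ∈ C.image D.head \ B.image D.head, ∀ U : Finset V, v ∈ U →
      U ⊆ insert v (B.image D.head) → (D.enteringArcs (B ∪ C) U).Nonempty := by
  by_contra! hclosed
  choose! U hvU hU hent using hclosed
  have hwitness : ∀ v ∈ C.image D.head \ B.image D.head,
      ∃ w ∈ U v, w ∈ B.image D.head \ C.image D.head := by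
    intro v hv
    have hUC : ¬ U v ⊆ C.image D.head := fun h =>
      ((hC.enteringArcs_nonempty ⟨v, hvU v hv⟩ h).mono
        (enteringArcs_mono subset_union_right _)).ne_empty (hent v hv)
    obtain ⟨w, hwU, hwC⟩ := not_subset.1 hUC
    have hwv : w ≠ v := fun h => hwC (h ▸ (mem_sdiff.1 hv).1)
    exact ⟨w, hwU, mem_sdiff.2 ⟨mem_of_mem_insert_of_ne (hU v hv hwU) hwv, hwC⟩⟩
  choose! w hwU hw using hwitness
  have hinj : Set.InjOn w (C.image D.head \ B.image D.head : Finset V) := by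
    intro v hv v' hv' heq
    by_contra hne
    have hinter : U v ∩ U v' ⊆ B.image D.head := by
      intro x hx
      have h := mem_insert.1 (hU v hv (mem_inter.1 hx).1)
      have h' := mem_insert.1 (hU v' hv' (mem_inter.1 hx).2)
      grind
    obtain ⟨e, he⟩ := hB.enteringArcs_nonempty
      ⟨w v, mem_inter.2 ⟨hwU v hv, heq ▸ hwU v' hv'⟩⟩ hinter
    have hnot : ∀ u ∈ C.image D.head \ B.image D.head, e ∉ D.enteringArcs (B ∪ C) (U u) :=
      fun u hu => by simp only [hent u hu, notMem_empty, not_false_eq_true]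
    have h := hnot v hv
    have h' := hnot v' hv'
    simp only [mem_enteringArcs, mem_union, mem_inter] at he h h'
    tauto
  have hle := card_le_card_of_injOn w hw hinj
  rw [card_sdiff_le_card_sdiff_iff, hB.card_image_head, hC.card_image_head] at hle
  exact hle.not_gt hcard

theorem cutCondition_move_head {v : V} (hBC : Disjoint B C) (hB : D.IsDiforest (B : Set E))
    (hC : D.IsDiforest (C : Set E))
    (hv : ∀ U : Finset V, v ∈ U → U ⊆ insert v (B.image D.head) →
      (D.enteringArcs (B ∪ C) U).Nonempty) :
    D.CutCondition (B ∪ C) ![insert v (B.image D.head), (C.image D.head).erase v] := by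
  intro U hU
  by_cases hvU : v ∈ U
  · have hle : #{i | U ⊆ ![insert v (B.image D.head), (C.image D.head).erase v] i} ≤
        if U ⊆ insert v (B.image D.head) then 1 else 0 := by
      rw [card_filter, Fin.sum_univ_two]
      split_ifs <;> simp_all [subset_erase]
    refine hle.trans ?_
    split_ifs with hUB
    exacts [(hv U hvU hUB).card_pos, Nat.zero_le _]
  · have hcut : D.CutCondition (B ∪ C) fun i => (![B, C] i).image D.head := by
      refine cutCondition_of_disjoint_diforests ?_ ?_ ?_
      · simp [Fin.forall_fin_two]
      · simp [Pairwise, Fin.forall_fin_two, hBC, hBC.symm]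
      · simp [Fin.forall_fin_two, hB, hC]
    refine le_trans (card_le_card (monotone_filter_right _ ?_)) (hcut U hU)
    simp [Fin.forall_fin_two, subset_erase, subset_insert_iff_of_notMem hvU, hvU]

end

theorem exists_exchange (hBC : Disjoint B C) (hB : D.IsDiforest (B : Set E))
    (hC : D.IsDiforest (C : Set E)) (hcard : #B < #C) :
    ∃ B' C' : Finset E, Disjoint B' C' ∧ B' ∪ C' = B ∪ C ∧ D.IsDiforest (B' : Set E) ∧
      D.IsDiforest (C' : Set E) ∧ #B' = #B + 1 ∧ #C' + 1 = #C := by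
  classical
  obtain ⟨v, hvCB, hv⟩ := exists_head_movable hB hC hcard
  obtain ⟨hvC, hvB⟩ := mem_sdiff.1 hvCB
  have hinsert : #(insert v (B.image D.head)) = #B + 1 := by
    rw [card_insert_of_notMem hvB, hB.card_image_head]
  have herase : #((C.image D.head).erase v) + 1 = #C := by
    rw [card_erase_add_one hvC, hC.card_image_head]
  obtain ⟨X, hdisj, hunion, hX⟩ :=
    (cutCondition_move_head hBC hB hC hv).exists_diforest_partition (by
      rw [card_union_of_disjoint hBC, Fin.sum_univ_two]
      simp only [Matrix.cons_val_zero, Matrix.cons_val_one]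
      omega)
  obtain ⟨⟨hX₀, hheads₀⟩, hX₁, hheads₁⟩ := Fin.forall_fin_two.1 hX
  refine ⟨X 0, X 1, hdisj zero_ne_one, ?_, hX₀, hX₁, ?_, ?_⟩
  · rw [← hunion]
    ext e
    simp [Fin.exists_fin_two]
  · rw [← hX₀.card_image_head, hheads₀, Matrix.cons_val_zero, hinsert]
  · rw [← hX₁.card_image_head, hheads₁, Matrix.cons_val_one, Matrix.cons_val_fin_one, herase]

end Exchange

/-- A colouring of the arcs whose colour classes are diforests, that is, a decomposition into
branchings indexed by the colours. -/
def IsDiforestColoring (D : MultiDigraph V E) (f : E → ι) : Prop :=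
  ∀ i, D.IsDiforest {e | f e = i}

theorem IsDiforestColoring.exists_recoloring [Finite E] {f : E → ι} {i j : ι}
    (hf : D.IsDiforestColoring f) (hij : {e | f e = i}.ncard < {e | f e = j}.ncard) :
    ∃ g : E → ι, D.IsDiforestColoring g ∧ {e | g e = i}.ncard = {e | f e = i}.ncard + 1 ∧
      {e | g e = j}.ncard + 1 = {e | f e = j}.ncard ∧
      ∀ l, l ≠ i → l ≠ j → {e | g e = l} = {e | f e = l} := by
  classical
  have := Fintype.ofFinite E
  have hne : i ≠ j := by rintro rfl; exact hij.false
  have hclass : ∀ l, (({e | f e = l} : Finset E) : Set E) = {e | f e = l} :=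
    fun l => coe_filter_univ _
  simp only [← hclass, Set.ncard_coe_finset] at hij ⊢
  obtain ⟨B, C, hBC, hunion, hB, hC, hcardB, hcardC⟩ := exists_exchange
    (disjoint_filter.2 fun e _ hi hj => hne (hi.symm.trans hj))
    (by rw [hclass]; exact hf i) (by rw [hclass]; exact hf j) hij
  simp only [Finset.ext_iff, mem_union, mem_filter_univ] at hunion
  rw [disjoint_left] at hBC
  let g : E → ι := fun e => if e ∈ B then i else if e ∈ C then j else f e
  have hgl : ∀ l, l ≠ i → l ≠ j → {e | g e = l} = {e | f e = l} := by
    intro l hli hlj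
    ext e
    have := hunion e
    grind
  have hgi : {e | g e = i} = (B : Set E) := by ext e; grind
  have hgj : {e | g e = j} = (C : Set E) := by ext e; grind
  refine ⟨g, fun l => ?_, by rwa [hgi, Set.ncard_coe_finset], by rwa [hgj, Set.ncard_coe_finset],
    by simpa only [hclass] using hgl⟩
  by_cases hli : l = i
  · rwa [hli, hgi]
  by_cases hlj : l = j
  · rwa [hlj, hgj]
  rw [hgl l hli hlj]
  exact hf l

theorem sum_sq_lt_sum_sq_of_transfer [Fintype ι] {a b : ι → ℕ} {i j : ι} (hlt : a i + 1 < a j)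
    (hi : b i = a i + 1) (hj : b j + 1 = a j) (hne : ∀ l, l ≠ i → l ≠ j → b l = a l) :
    ∑ l, b l ^ 2 < ∑ l, a l ^ 2 := by
  classical
  have hij : i ≠ j := by rintro rfl; omega
  have hsplit : ∀ c : ι → ℕ, ∑ l, c l ^ 2 =
      c i ^ 2 + c j ^ 2 + ∑ l ∈ ({i, j} : Finset ι)ᶜ, c l ^ 2 := fun c => by
    rw [← sum_add_sum_compl {i, j}, sum_pair hij]
  have hrest : ∑ l ∈ ({i, j} : Finset ι)ᶜ, b l ^ 2 = ∑ l ∈ ({i, j} : Finset ι)ᶜ, a l ^ 2 :=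
    sum_congr rfl fun l hl => by
      simp only [mem_compl, mem_insert, mem_singleton, not_or] at hl
      rw [hne l hl.1 hl.2]
  rw [hsplit, hsplit, hrest, hi, ← hj]
  nlinarith

theorem IsDiforestColoring.exists_balanced [Finite E] [Finite ι] {f : E → ι}
    (hf : D.IsDiforestColoring f) :
    ∃ g : E → ι, D.IsDiforestColoring g ∧
      ∀ i j, {e | g e = i}.ncard ≤ {e | g e = j}.ncard + 1 := by
  have := Fintype.ofFinite ι
  obtain ⟨g, hg, hmin⟩ := Set.exists_min_image {f : E → ι | D.IsDiforestColoring f}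
    (fun f => ∑ i, {e | f e = i}.ncard ^ 2) (Set.toFinite _) ⟨f, hf⟩
  refine ⟨g, hg, fun i j => ?_⟩
  by_contra! hij
  obtain ⟨g', hg', hj, hi, hrest⟩ := IsDiforestColoring.exists_recoloring (i := j) (j := i) hg
    (by omega)
  exact (hmin g' hg').not_gt <|
    sum_sq_lt_sum_sq_of_transfer hij hj hi fun l hlj hli => by rw [hrest l hlj hli]

/-! ### Branchings are the spanning subdigraphs whose arc sets are diforests -/

namespace Subdigraph

variable {H : D.Subdigraph} {u v w r x : V} {l p q : List (E × Bool)} {d : E × Bool} {e : E}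

section Walk

theorem source_mem (hd : d.1 ∈ H.arcs) : D.source d ∈ H.verts := by
  obtain ⟨e, _ | _⟩ := d
  exacts [H.head_mem e hd, H.tail_mem e hd]

theorem target_mem (hd : d.1 ∈ H.arcs) : D.target d ∈ H.verts := by
  obtain ⟨e, _ | _⟩ := d
  exacts [H.tail_mem e hd, H.head_mem e hd]

theorem IsWalk.left_mem (h : H.IsWalk u l v) : u ∈ H.verts := by
  cases l with
  | nil => exact h.1
  | cons d l => exact h.2.1 ▸ source_mem h.1

theorem isWalk_append : H.IsWalk u (p ++ q) w ↔ ∃ v, H.IsWalk u p v ∧ H.IsWalk v q w := by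
  induction p generalizing u with
  | nil =>
    refine ⟨fun h => ⟨u, ⟨h.left_mem, rfl⟩, h⟩, ?_⟩
    rintro ⟨v, ⟨-, rfl⟩, h⟩
    exact h
  | cons d p ih => simp only [List.cons_append, IsWalk, ih, exists_and_left, and_assoc]

theorem isWalk_concat :
    H.IsWalk u (p ++ [d]) w ↔ H.IsWalk u p (D.source d) ∧ d.1 ∈ H.arcs ∧ D.target d = w := by
  rw [isWalk_append]
  constructor
  · rintro ⟨v, hp, hd, rfl, -, hw⟩
    exact ⟨hp, hd, hw⟩
  · rintro ⟨hp, hd, hw⟩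
    exact ⟨_, hp, hd, rfl, target_mem hd, hw⟩

theorem IsWalk.fst_mem_arcs (h : H.IsWalk u l v) (hd : d ∈ l) : d.1 ∈ H.arcs := by
  obtain ⟨p, q, rfl⟩ := List.append_of_mem hd
  obtain ⟨_, -, hq⟩ := isWalk_append.1 h
  exact hq.1

theorem IsWalk.source_mem_cons (h : H.IsWalk u l v) (hd : d ∈ l) :
    D.source d ∈ u :: l.map D.target := by
  induction l generalizing u with
  | nil => simp at hd
  | cons d' l ih =>
    rcases List.mem_cons.1 hd with rfl | hd
    · simp [h.2.1]
    · exact List.mem_cons_of_mem _ (ih h.2.2 hd)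

theorem IsWalk.right_mem_map_target (h : H.IsWalk u l v) (hl : l ≠ []) : v ∈ l.map D.target := by
  obtain ⟨p, d, rfl⟩ := (List.eq_nil_or_concat' l).resolve_left hl
  simp [← (isWalk_concat.1 h).2.2]

theorem Reachable.refl (hu : u ∈ H.verts) : H.Reachable u u :=
  ⟨[], hu, rfl⟩

theorem Reachable.trans (h : H.Reachable u v) (h' : H.Reachable v w) : H.Reachable u w :=
  ⟨_, isWalk_append.2 ⟨v, h.choose_spec, h'.choose_spec⟩⟩

theorem reachable_of_arc (hd : d.1 ∈ H.arcs) : H.Reachable (D.source d) (D.target d) :=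
  ⟨[d], hd, rfl, target_mem hd, rfl⟩

theorem Reachable.symm (h : H.Reachable u v) : H.Reachable v u := by
  obtain ⟨l, hl⟩ := h
  induction l generalizing u with
  | nil => exact ⟨[], hl.2 ▸ hl.1, hl.2.symm⟩
  | cons d l ih =>
    obtain ⟨hd, rfl, hl⟩ := hl
    refine (ih hl).trans ?_
    obtain ⟨e, b⟩ := d
    have := reachable_of_arc (H := H) (d := (e, !b)) hd
    cases b <;> exact this

theorem component_eq_of_reachable (h : H.Reachable u v) : H.component u = H.component v := by
  have hiff : ∀ x, H.Reachable u x ↔ H.Reachable v x := fun x => ⟨h.symm.trans, h.trans⟩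
  ext x <;> simp only [component, hiff]

theorem isWalk_component_iff (h : H.Reachable r u) :
    (H.component r).IsWalk u l v ↔ H.IsWalk u l v := by
  induction l generalizing u with
  | nil =>
    simp only [IsWalk, component, Set.mem_ofPred_eq]
    tauto
  | cons d l ih =>
    obtain ⟨e, b⟩ := d
    constructor
    · rintro ⟨⟨he, htail, hhead⟩, hu, hl⟩
      refine ⟨he, hu, (ih ?_).1 hl⟩
      cases b <;> assumption
    · rintro ⟨he, rfl, hl⟩
      have htarget := h.trans (reachable_of_arc he)
      refine ⟨⟨he, ?_⟩, rfl, (ih htarget).2 hl⟩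
      cases b
      exacts [⟨htarget, h⟩, ⟨h, htarget⟩]

end Walk

section ForwardWalk

/-- A walk that traverses every arc forwards; it may visit vertices repeatedly, in contrast to a
directed path. -/
def IsForwardWalk (H : D.Subdigraph) (u : V) (l : List (E × Bool)) (v : V) : Prop :=
  H.IsWalk u l v ∧ ∀ d ∈ l, d.2 = true

theorem isForwardWalk_concat : H.IsForwardWalk u (p ++ [d]) w ↔
    H.IsForwardWalk u p (D.tail d.1) ∧ d.1 ∈ H.arcs ∧ d.2 = true ∧ D.head d.1 = w := by
  obtain ⟨e, b⟩ := d
  simp only [IsForwardWalk, isWalk_concat, List.forall_mem_append, List.forall_mem_singleton]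
  constructor
  · rintro ⟨⟨hp, he, hw⟩, hfwd, rfl⟩
    exact ⟨⟨hp, hfwd⟩, he, rfl, hw⟩
  · rintro ⟨⟨hp, hfwd⟩, he, rfl, hw⟩
    exact ⟨⟨hp, he, hw⟩, hfwd, rfl⟩

theorem map_target_of_forward (h : ∀ d ∈ l, d.2 = true) :
    l.map D.target = (l.map Prod.fst).map D.head := by
  rw [List.map_map]
  exact List.map_congr_left fun d hd => if_pos (h d hd)

theorem IsForwardWalk.pairwise_rank_lt {rank : V → ℕ}
    (hrank : ∀ e ∈ H.arcs, rank (D.tail e) < rank (D.head e)) (h : H.IsForwardWalk u l v) :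
    (u :: l.map D.target).Pairwise fun x y => rank x < rank y := by
  have : Trans (fun x y : V => rank x < rank y) (fun x y => rank x < rank y)
    fun x y => rank x < rank y := ⟨lt_trans⟩
  rw [← List.isChain_iff_pairwise]
  induction l generalizing u with
  | nil => exact List.isChain_singleton u
  | cons d l ih =>
    obtain ⟨e, b⟩ := d
    obtain ⟨⟨he, rfl, hl⟩, hfwd⟩ := h
    obtain ⟨rfl, hfwd'⟩ := List.forall_mem_cons.1 hfwd
    exact List.isChain_cons_cons.2 ⟨hrank e he, ih ⟨hl, hfwd'⟩⟩

theorem IsForwardWalk.rank_le {rank : V → ℕ}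
    (hrank : ∀ e ∈ H.arcs, rank (D.tail e) < rank (D.head e)) (h : H.IsForwardWalk u l v) :
    rank u ≤ rank v := by
  rcases eq_or_ne l [] with rfl | hl
  · rw [h.1.2]
  · exact ((List.pairwise_cons.1 (h.pairwise_rank_lt hrank)).1 v (h.1.right_mem_map_target hl)).le

theorem IsForwardWalk.isDirectedPath (hH : D.IsDiforest H.arcs) (h : H.IsForwardWalk u l v) :
    H.IsDirectedPath u l v := by
  obtain ⟨-, rank, hrank⟩ := hH
  exact ⟨h.1, h.2, (h.pairwise_rank_lt hrank).imp fun hlt heq => hlt.ne (congrArg rank heq)⟩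

theorem IsForwardWalk.unique (hinj : Set.InjOn D.head H.arcs) (hr : r ∉ D.head '' H.arcs)
    (hp : H.IsForwardWalk r p u) (hq : H.IsForwardWalk r q u) : p = q := by
  induction p using List.reverseRecOn generalizing u q with
  | nil =>
    rcases List.eq_nil_or_concat' q with rfl | ⟨q, d, rfl⟩
    · rfl
    · obtain ⟨-, hd, -, hu⟩ := isForwardWalk_concat.1 hq
      exact absurd ⟨_, hd, hu.trans hp.1.2.symm⟩ hr
  | append_singleton p d ih =>
    obtain ⟨hp, hd, hfwd, hu⟩ := isForwardWalk_concat.1 hp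
    rcases List.eq_nil_or_concat' q with rfl | ⟨q, d', rfl⟩
    · exact absurd ⟨_, hd, hu.trans hq.1.2.symm⟩ hr
    · obtain ⟨hq, hd', hfwd', hu'⟩ := isForwardWalk_concat.1 hq
      obtain rfl : d = d' := Prod.ext (hinj hd hd' (hu.trans hu'.symm)) (hfwd.trans hfwd'.symm)
      rw [ih hp hq]

theorem exists_forwardWalk_of_isWalk (hinj : Set.InjOn D.head H.arcs) (hr : r ∉ D.head '' H.arcs)
    (hl : H.IsWalk u l v) (hp : ∃ p, H.IsForwardWalk r p u) : ∃ p, H.IsForwardWalk r p v := by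
  induction l generalizing u with
  | nil => exact hl.2 ▸ hp
  | cons d l ih =>
    obtain ⟨he, rfl, hl⟩ := hl
    refine ih hl ?_
    obtain ⟨p, hp⟩ := hp
    obtain ⟨e, _ | _⟩ := d
    · rcases List.eq_nil_or_concat' p with rfl | ⟨p, d', rfl⟩
      · exact absurd ⟨e, he, hp.1.2.symm⟩ hr
      · obtain ⟨hp', hd', -, hhead⟩ := isForwardWalk_concat.1 hp
        obtain rfl : d'.1 = e := hinj hd' he hhead
        exact ⟨p, hp'⟩
    · exact ⟨p ++ [(e, true)], isForwardWalk_concat.2 ⟨hp, he, rfl, rfl⟩⟩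

theorem exists_root_forwardWalk (hH : D.IsDiforest H.arcs) (hv : v ∈ H.verts) :
    ∃ r ∉ D.head '' H.arcs, ∃ p, H.IsForwardWalk r p v := by
  obtain ⟨-, rank, hrank⟩ := hH
  induction hn : rank v using Nat.strong_induction_on generalizing v with
  | _ n ih =>
  by_cases hroot : v ∈ D.head '' H.arcs
  · obtain ⟨e, he, rfl⟩ := hroot
    obtain ⟨r, hr, p, hp⟩ := ih _ (hn ▸ hrank e he) (H.tail_mem e he) rfl
    exact ⟨r, hr, p ++ [(e, true)], isForwardWalk_concat.2 ⟨hp, he, rfl, rfl⟩⟩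
  · exact ⟨v, hroot, [], ⟨hv, rfl⟩, by simp⟩

end ForwardWalk

theorem IsDirectedPath.exists_suffix (h : H.IsDirectedPath u l v)
    (hx : x ∈ u :: l.map D.target) : ∃ q, H.IsDirectedPath x q v := by
  induction l generalizing u with
  | nil => exact ⟨[], List.mem_singleton.1 hx ▸ h⟩
  | cons d l ih =>
    rcases List.mem_cons.1 hx with rfl | hx
    · exact ⟨_, h⟩
    · exact ih ⟨h.1.2.2, (List.forall_mem_cons.1 h.2.1).2, (List.nodup_cons.1 h.2.2).2⟩ hx

theorem IsDirectedPath.isCycle_concat (hq : H.IsDirectedPath (D.head e) q (D.tail e))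
    (he : e ∈ H.arcs) : H.IsCycle (D.head e) (q ++ [(e, true)]) := by
  obtain ⟨hwalk, hfwd, hnodup⟩ := hq
  have hw : H.IsForwardWalk (D.head e) (q ++ [(e, true)]) (D.head e) :=
    isForwardWalk_concat.2 ⟨⟨hwalk, hfwd⟩, he, rfl, rfl⟩
  have htarget : ((q ++ [(e, true)]).map D.target).Nodup := by
    rw [List.map_append]
    exact (List.perm_append_singleton _ _).nodup_iff.2 hnodup
  exact ⟨hw.1, by simp, .of_map D.head (map_target_of_forward hw.2 ▸ htarget), htarget⟩

theorem IsArborescence.isDirectedPath_concat (hH : H.IsArborescence r) (he : e ∈ H.arcs)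
    (hl : H.IsDirectedPath r l (D.tail e)) : H.IsDirectedPath r (l ++ [(e, true)]) (D.head e) := by
  obtain ⟨hwalk, hfwd⟩ : H.IsForwardWalk r (l ++ [(e, true)]) (D.head e) :=
    isForwardWalk_concat.2 ⟨⟨hl.1, hl.2.1⟩, he, rfl, rfl⟩
  have hnotMem : D.head e ∉ r :: l.map D.target := fun hmem => by
    obtain ⟨q, hq⟩ := hl.exists_suffix hmem
    exact hH.1.2.2 _ _ (hq.isCycle_concat he)
  refine ⟨hwalk, hfwd, ?_⟩
  rw [List.map_append, ← List.cons_append]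
  exact (List.perm_append_singleton _ _).nodup_iff.2 (List.nodup_cons.2 ⟨hnotMem, hl.2.2⟩)

theorem IsArborescence.isDiforest (hH : H.IsArborescence r) : D.IsDiforest H.arcs := by
  have hpath := hH.2.2
  choose! p hp huniq using hpath
  have hconcat : ∀ e ∈ H.arcs, p (D.head e) = p (D.tail e) ++ [(e, true)] := fun e he =>
    (huniq _ (H.head_mem e he) _ (hH.isDirectedPath_concat he (hp _ (H.tail_mem e he)))).symm
  refine ⟨fun e he f hf hef => ?_, fun v => (p v).length, fun e he => by simp [hconcat e he]⟩
  have heq := hconcat e he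
  rw [hef, hconcat f hf] at heq
  exact congrArg Prod.fst (List.singleton_inj.1 (List.append_inj_right' heq rfl).symm)

theorem IsBranching.isDiforest (hH : H.IsBranching) : D.IsDiforest H.arcs := by
  have hcomponent : ∀ v ∈ H.verts, D.IsDiforest (H.component v).arcs := fun v hv =>
    (hH.2 v hv).choose_spec.isDiforest
  have hmem : ∀ e ∈ H.arcs, e ∈ (H.component (D.head e)).arcs := fun e he =>
    ⟨he, reachable_of_arc (d := (e, false)) he, .refl (H.head_mem e he)⟩
  have hrank : ∀ C : D.Subdigraph, D.IsDiforest C.arcs →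
      ∃ rank : V → ℕ, ∀ e ∈ C.arcs, rank (D.tail e) < rank (D.head e) := fun _ hC => hC.2
  choose! rank hrank using hrank
  refine ⟨fun e he f hf hef => ?_, fun v => rank (H.component v) v, fun e he => ?_⟩
  · exact (hcomponent _ (H.head_mem e he)).1 (hmem e he) (hef ▸ hmem f hf) hef
  · have heq : H.component (D.tail e) = H.component (D.head e) :=
      component_eq_of_reachable (reachable_of_arc (d := (e, true)) he)
    dsimp only
    rw [heq]
    exact hrank _ (hcomponent _ (H.head_mem e he)) e (hmem e he)

/-- A cycle has as many arcs as vertices, so that in a diforest each of its vertices would be the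
head of one of its arcs. -/
theorem not_isCycle_of_isDiforest (hH : D.IsDiforest H.arcs) : ¬ H.IsCycle u l := by
  classical
  rintro ⟨hwalk, hne, harcs, hverts⟩
  set F := (l.map Prod.fst).toFinset with hF
  set T := (l.map D.target).toFinset with hT
  have hcard : #F = #T := by
    rw [hF, hT, List.toFinset_card_of_nodup harcs, List.toFinset_card_of_nodup hverts,
      List.length_map, List.length_map]
  have hends : ∀ e ∈ F, D.tail e ∈ T ∧ D.head e ∈ T := by
    intro e he
    obtain ⟨⟨e, b⟩, hd, rfl⟩ := List.mem_map.1 (List.mem_toFinset.1 he)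
    have htarget : D.target (e, b) ∈ T := List.mem_toFinset.2 (List.mem_map_of_mem hd)
    have hsource : D.source (e, b) ∈ T := List.mem_toFinset.2 <| by
      rcases List.mem_cons.1 (hwalk.source_mem_cons hd) with h | h
      · exact h ▸ hwalk.right_mem_map_target hne
      · exact h
    cases b
    exacts [⟨htarget, hsource⟩, ⟨hsource, htarget⟩]
  have hforest : D.IsDiforest (F : Set E) := hH.mono fun e he => by
    obtain ⟨d, hd, rfl⟩ := List.mem_map.1 (List.mem_toFinset.1 (mem_coe.1 he))
    exact hwalk.fst_mem_arcs hd
  have himage : F.image D.head = T := eq_of_subset_of_card_le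
    (image_subset_iff.2 fun e he => (hends e he).2) (by rw [hforest.card_image_head, hcard])
  obtain ⟨e, he⟩ := hforest.enteringArcs_nonempty
    ⟨u, List.mem_toFinset.2 (hwalk.right_mem_map_target hne)⟩ himage.ge
  obtain ⟨heF, -, htail⟩ := mem_enteringArcs.1 he
  exact htail (hends e heF).1

theorem component_isArborescence (hH : D.IsDiforest H.arcs) (hr : r ∉ D.head '' H.arcs)
    (hrV : r ∈ H.verts) : (H.component r).IsArborescence r := by
  have hrr : H.Reachable r r := .refl hrV
  refine ⟨⟨⟨r, hrV, hrr⟩, ?_, fun u l => ?_⟩, ⟨hrV, hrr⟩, ?_⟩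
  · rintro u ⟨-, hu⟩ w ⟨-, hw⟩
    obtain ⟨l, hl⟩ := hu.symm.trans hw
    exact ⟨l, (isWalk_component_iff hu).2 hl⟩
  · exact not_isCycle_of_isDiforest (hH.mono fun e he => he.1)
  · rintro u ⟨-, l, hl⟩
    obtain ⟨q, hq⟩ := exists_forwardWalk_of_isWalk hH.1 hr hl ⟨[], ⟨hrV, rfl⟩, by simp⟩
    have hpath := hq.isDirectedPath hH
    refine ⟨q, ⟨(isWalk_component_iff hrr).2 hpath.1, hpath.2⟩, ?_⟩
    rintro q' ⟨hwalk, hfwd, -⟩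
    exact IsForwardWalk.unique hH.1 hr ⟨(isWalk_component_iff hrr).1 hwalk, hfwd⟩ hq

theorem isBranching_iff : H.IsBranching ↔ H.verts = Set.univ ∧ D.IsDiforest H.arcs := by
  refine ⟨fun hH => ⟨hH.1, hH.isDiforest⟩, fun ⟨hV, hH⟩ => ⟨hV, fun v hv => ?_⟩⟩
  obtain ⟨r, hr, p, hp⟩ := exists_root_forwardWalk hH hv
  rw [← component_eq_of_reachable ⟨p, hp.1⟩]
  exact ⟨r, component_isArborescence hH hr hp.1.left_mem⟩

theorem IsBranching.rootSet_eq (hH : H.IsBranching) : H.rootSet = (D.head '' H.arcs)ᶜ := by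
  obtain ⟨hV, hforest⟩ := isBranching_iff.1 hH
  ext r
  constructor
  · rintro ⟨v, -, hv⟩ ⟨e, he, rfl⟩
    obtain ⟨rank, hrank⟩ := hforest.2
    have hvr := hv.2.1.2
    obtain ⟨l, ⟨hwalk, hfwd, -⟩, -⟩ := hv.2.2 (D.tail e)
      ⟨H.tail_mem e he, hvr.trans (reachable_of_arc (d := (e, false)) he)⟩
    have hl : H.IsForwardWalk (D.head e) l (D.tail e) := ⟨(isWalk_component_iff hvr).1 hwalk, hfwd⟩
    exact (hl.rank_le hrank).not_gt (hrank e he)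
  · intro hr
    have hrV : r ∈ H.verts := hV ▸ Set.mem_univ r
    exact ⟨r, hrV, component_isArborescence hforest hr hrV⟩

theorem IsBranching.ncard_rootSet_add_size [Finite V] (hH : H.IsBranching) :
    H.rootSet.ncard + H.size = Nat.card V := by
  rw [hH.rootSet_eq, size, ← hH.isDiforest.1.ncard_image, add_comm, Set.ncard_add_ncard_compl]

end Subdigraph

/-! ### Existence of a colouring by diforests -/

/-- The digraph obtained from `D` by adding a vertex `none` and, for each vertex `v` of `S`, as many
arcs from `none` to `v` as are needed for `v` to have in-degree `k`. In a partition of its arcs into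
`k` diforests with the same set `S` of heads, the arcs of `D` are coloured by `k` diforests. -/
def rootExtension (D : MultiDigraph V E) (S : Finset V) (k : ℕ) :
    MultiDigraph (Option V) (E ⊕ Σ v : S, Fin (k - D.inDegree v)) where
  tail := Sum.elim (fun e => some (D.tail e)) fun _ => none
  head := Sum.elim (fun e => some (D.head e)) fun x => some x.1
  tail_ne_head := by
    rintro (e | x)
    exacts [fun h => D.tail_ne_head e (Option.some_injective V h), (Option.some_ne_none _).symm]

theorem IsDiforest.of_rootExtension {S : Finset V} {k : ℕ}
    {B : Set (E ⊕ Σ v : S, Fin (k - D.inDegree v))} (hB : (D.rootExtension S k).IsDiforest B) :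
    D.IsDiforest (Sum.inl ⁻¹' B) := by
  obtain ⟨hinj, rank, hrank⟩ := hB
  exact ⟨fun e he f hf hef => Sum.inl_injective (hinj he hf (congrArg some hef)),
    fun v => rank (some v), fun e he => hrank _ he⟩

section Existence

variable [DecidableEq V] [Fintype E] {S X : Finset V} {k : ℕ}

theorem sum_inDegree (X : Finset V) : ∑ v ∈ X, D.inDegree v = #{e | D.head e ∈ X} := by
  simp only [inDegree, ← coe_filter_univ, Set.ncard_coe_finset]
  exact sum_card_fiberwise_eq_card_filter _ _ _

theorem card_enteringArcs_rootExtension (hXS : X ⊆ S) :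
    #((D.rootExtension S k).enteringArcs univ (X.map .some)) =
      #(D.enteringArcs univ X) + ∑ v ∈ X, (k - D.inDegree v) := by
  rw [enteringArcs, card_filter, Fintype.sum_sum_type, Fintype.sum_sigma, enteringArcs, card_filter]
  congr 1
  · simp [rootExtension]
  · calc _ = ∑ v : S, if (v : V) ∈ X then k - D.inDegree v else 0 := by simp [rootExtension]
      _ = ∑ v ∈ X, (k - D.inDegree v) := by
        rw [sum_coe_sort S fun v => if v ∈ X then k - D.inDegree v else 0, ← sum_filter,
          filter_mem_eq_inter, inter_eq_right.2 hXS]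

theorem card_enteringArcs_rootExtension_add (hdeg : ∀ v, D.inDegree v ≤ k) (hXS : X ⊆ S) :
    #((D.rootExtension S k).enteringArcs univ (X.map .some)) +
      #{e | D.tail e ∈ X ∧ D.head e ∈ X} = k * #X := by
  have hheads : #{e | D.tail e ∈ X ∧ D.head e ∈ X} + #(D.enteringArcs univ X) =
      ∑ v ∈ X, D.inDegree v := by
    rw [sum_inDegree, ← card_filter_add_card_filter_not (s := {e | D.head e ∈ X})
      (fun e => D.tail e ∈ X), filter_filter, filter_filter, enteringArcs]
    simp only [and_comm]
  have hsum : ∑ v ∈ X, (k - D.inDegree v) + ∑ v ∈ X, D.inDegree v = k * #X := by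
    rw [← sum_add_distrib, sum_congr rfl fun v _ => Nat.sub_add_cancel (hdeg v), sum_const,
      smul_eq_mul, mul_comm]
  rw [card_enteringArcs_rootExtension hXS]
  omega

theorem cutCondition_rootExtension (hdeg : ∀ v, D.inDegree v ≤ k)
    (hsparse : ∀ U : Finset V, U.Nonempty →
      #{e | D.tail e ∈ U ∧ D.head e ∈ U} + k ≤ k * #U) :
    (D.rootExtension S k).CutCondition univ fun _ : Fin k => S.map .some := by
  intro U hU
  by_cases hUS : U ⊆ S.map .some
  · obtain ⟨X, hXS, rfl⟩ := subset_map_iff.1 hUS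
    have hcount := card_enteringArcs_rootExtension_add hdeg hXS
    have hX := hsparse X (map_nonempty.1 hU)
    have hk := card_finset_fin_le {_i : Fin k | X.map .some ⊆ S.map .some}
    lia
  · simp only [hUS, filter_false, card_empty, zero_le]

end Existence

theorem card_arcs_rootExtension [Fintype E] {S : Finset V} {k : ℕ} (hdeg : ∀ v, D.inDegree v ≤ k)
    (hS : ∀ e, D.head e ∈ S) :
    Fintype.card (E ⊕ Σ v : S, Fin (k - D.inDegree v)) = k * #S := by
  classical
  have hE : Fintype.card E = ∑ v ∈ S, D.inDegree v := by
    rw [sum_inDegree, filter_true_of_mem fun e _ => hS e, card_univ]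
  rw [Fintype.card_sum, Fintype.card_sigma, hE]
  simp only [Fintype.card_fin]
  rw [sum_coe_sort S fun v => k - D.inDegree v, ← sum_add_distrib,
    sum_congr rfl fun v _ => Nat.add_sub_cancel' (hdeg v), sum_const, smul_eq_mul, mul_comm]

/-- **Frank's theorem.** -/
theorem exists_isDiforestColoring [Finite E] {k : ℕ} (hdeg : ∀ v, D.inDegree v ≤ k)
    (hsparse : ∀ U : Finset V, U.Nonempty →
      {e | D.tail e ∈ U ∧ D.head e ∈ U}.ncard + k ≤ k * #U) :
    ∃ f : E → Fin k, D.IsDiforestColoring f := by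
  classical
  have := Fintype.ofFinite E
  simp only [← coe_filter_univ, Set.ncard_coe_finset] at hsparse
  have hS : ∀ e, D.head e ∈ univ.image D.head := fun e => mem_image_of_mem _ (mem_univ e)
  obtain ⟨B, -, hunion, hB⟩ := (cutCondition_rootExtension hdeg hsparse).exists_diforest_partition
    (by rw [card_univ, card_arcs_rootExtension hdeg hS, sum_const, card_map, card_univ,
      Fintype.card_fin, smul_eq_mul])
  have hcover : ∀ e : E, ∃ i, Sum.inl e ∈ B i := fun e => by
    simpa using hunion.ge (mem_univ (Sum.inl e))
  choose f hf using hcover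
  refine ⟨f, fun i => (hB i).1.of_rootExtension.mono ?_⟩
  rintro e rfl
  exact hf e

theorem inDegree_le_maxInDegree [Finite E] (v : V) : D.inDegree v ≤ D.maxInDegree :=
  le_ciSup (f := D.inDegree) ⟨Nat.card E, Set.forall_mem_range.2 fun _ => Set.ncard_le_card _⟩ v

theorem ncard_arcs_add_le_of_fractionalArboricity_le [Finite E] {k : ℕ}
    (hD : D.fractionalArboricity ≤ k) (H : D.Subdigraph) (hH : 2 ≤ H.verts.ncard) :
    H.arcs.ncard + k ≤ k * H.verts.ncard := by
  have hbdd : BddAbove {q | ∃ H : D.Subdigraph, 2 ≤ H.verts.ncard ∧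
      q = (H.arcs.ncard : ℝ) / ((H.verts.ncard : ℝ) - 1)} := by
    refine ⟨Nat.card E, ?_⟩
    rintro q ⟨H, hH, rfl⟩
    have hverts : (2 : ℝ) ≤ H.verts.ncard := by exact_mod_cast hH
    refine (div_le_self (Nat.cast_nonneg _) (by linarith)).trans ?_
    exact_mod_cast Set.ncard_le_card H.arcs
  have hverts : (2 : ℝ) ≤ H.verts.ncard := by exact_mod_cast hH
  have hle := (le_csSup hbdd ⟨H, hH, rfl⟩).trans hD
  rw [div_le_iff₀ (by linarith)] at hle
  have hadd : (H.arcs.ncard : ℝ) + k ≤ k * H.verts.ncard := by linarith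
  exact_mod_cast hadd

theorem exists_isDiforestColoring_of_fractionalArboricity_le [Finite E] {k : ℕ}
    (hdeg : D.maxInDegree ≤ k) (harb : D.fractionalArboricity ≤ k) :
    ∃ f : E → Fin k, D.IsDiforestColoring f := by
  refine exists_isDiforestColoring (fun v => (inDegree_le_maxInDegree v).trans hdeg) fun U hU => ?_
  obtain hone | htwo : #U = 1 ∨ 2 ≤ #U := by have := hU.card_pos; omega
  · obtain ⟨v, rfl⟩ := card_eq_one.1 hone
    have hempty : {e | D.tail e ∈ ({v} : Finset V) ∧ D.head e ∈ ({v} : Finset V)} = ∅ :=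
      Set.eq_empty_of_forall_notMem fun e he =>
        D.tail_ne_head e ((mem_singleton.1 he.1).trans (mem_singleton.1 he.2).symm)
    rw [hempty, Set.ncard_empty, hone, zero_add, mul_one]
  · rw [← Set.ncard_coe_finset U] at htwo ⊢
    exact ncard_arcs_add_le_of_fractionalArboricity_le harb
      ⟨U, {e | D.tail e ∈ U ∧ D.head e ∈ U}, fun e he => he.1, fun e he => he.2⟩ htwo

theorem IsBranchingCover.exists_isDiforestColoring {k : ℕ} {B : Fin k → D.Subdigraph}
    (hB : D.IsBranchingCover B) : ∃ f : E → Fin k, D.IsDiforestColoring f := by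
  choose f hf using hB.2
  exact ⟨f, fun i => (hB.1 i).isDiforest.mono fun e (he : f e = i) => he ▸ hf e⟩

theorem IsDiforestColoring.exists_isBranchingDecomposition {k : ℕ} {f : E → Fin k}
    (hf : D.IsDiforestColoring f) :
    ∃ B : Fin k → D.Subdigraph, D.IsBranchingDecomposition B ∧ ∀ i, (B i).arcs = {e | f e = i} := by
  refine ⟨fun i => ⟨Set.univ, {e | f e = i}, fun _ _ => trivial, fun _ _ => trivial⟩,
    ⟨⟨fun i => Subdigraph.isBranching_iff.2 ⟨rfl, hf i⟩, fun e => ⟨f e, rfl⟩⟩, ?_⟩, fun _ => rfl⟩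
  exact fun i j hij => Set.disjoint_left.2 fun e (hi : f e = i) hj => hij (hi.symm.trans hj)

theorem IsBranchingDecomposition.sum_size [Finite E] {k : ℕ} {B : Fin k → D.Subdigraph}
    (hB : D.IsBranchingDecomposition B) : ∑ i, (B i).size = Nat.card E := by
  have hunion : ⋃ i, (B i).arcs = Set.univ := Set.iUnion_eq_univ_iff.2 hB.1.2
  rw [← Set.ncard_univ, ← hunion, Set.ncard_iUnion_of_finite (fun _ => Set.toFinite _) hB.2,
    finsum_eq_sum_of_fintype]
  rfl

theorem eq_floor_or_eq_ceil_of_balanced {K : Type*} [Field K] [LinearOrder K]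
    [IsStrictOrderedRing K] [FloorRing K] [Fintype ι] {a : ι → ℤ} (ha : ∀ i j, a i ≤ a j + 1)
    (i : ι) :
    a i = ⌊((∑ j, a j : ℤ) : K) / Fintype.card ι⌋ ∨
      a i = ⌈((∑ j, a j : ℤ) : K) / Fintype.card ι⌉ := by
  have hpos : (0 : K) < Fintype.card ι := Nat.cast_pos.2 (Fintype.card_pos_iff.2 ⟨i⟩)
  have hlt : ∑ j, a j < Fintype.card ι * (a i + 1) := by
    simpa using sum_lt_sum (fun j _ => ha j i) ⟨i, mem_univ i, lt_add_one (a i)⟩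
  have hgt : Fintype.card ι * (a i - 1) < ∑ j, a j := by
    simpa [mul_sub] using sum_lt_sum (fun j _ => sub_le_iff_le_add.2 (ha i j))
      ⟨i, mem_univ i, sub_one_lt (a i)⟩
  have hlt' : ((∑ j, a j : ℤ) : K) < (a i + 1) * Fintype.card ι := by
    rw [mul_comm]; exact_mod_cast hlt
  have hgt' : (a i - 1) * Fintype.card ι < ((∑ j, a j : ℤ) : K) := by
    rw [mul_comm]; exact_mod_cast hgt
  rcases le_total ((a i : K) * Fintype.card ι) (∑ j, a j : ℤ) with hle | hle
  · left
    rw [eq_comm, Int.floor_eq_iff, le_div_iff₀ hpos, div_lt_iff₀ hpos]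
    exact ⟨hle, hlt'⟩
  · right
    rw [eq_comm, Int.ceil_eq_iff, lt_div_iff₀ hpos, div_le_iff₀ hpos]
    exact ⟨hgt', hle⟩

theorem IsBranchingDecomposition.size_eq_floor_or_ceil [Finite E] {k : ℕ}
    {B : Fin k → D.Subdigraph} (hB : D.IsBranchingDecomposition B)
    (hbal : ∀ i j, (B i).size ≤ (B j).size + 1) (i : Fin k) :
    (B i).size = ⌊(Nat.card E : ℝ) / k⌋₊ ∨ (B i).size = ⌈(Nat.card E : ℝ) / k⌉₊ := by
  have hsize := eq_floor_or_eq_ceil_of_balanced (K := ℝ) (a := fun i => ((B i).size : ℤ))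
    (fun i j => by exact_mod_cast hbal i j) i
  rw [← Nat.cast_sum, hB.sum_size, Int.cast_natCast, Fintype.card_fin,
    ← Int.natCast_floor_eq_floor (by positivity), ← Int.natCast_ceil_eq_ceil (by positivity)]
    at hsize
  exact_mod_cast hsize

theorem IsBranchingDecomposition.ncard_rootSet_eq_floor_or_ceil [Finite V] [Finite E] {k : ℕ}
    {B : Fin k → D.Subdigraph} (hB : D.IsBranchingDecomposition B)
    (hbal : ∀ i j, (B i).size ≤ (B j).size + 1) (i : Fin k) :
    ((B i).rootSet.ncard : ℤ) = ⌊(((k : ℤ) * Nat.card V - Nat.card E : ℤ) : ℝ) / k⌋ ∨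
      ((B i).rootSet.ncard : ℤ) = ⌈(((k : ℤ) * Nat.card V - Nat.card E : ℤ) : ℝ) / k⌉ := by
  have hroot : ∀ i, ((B i).rootSet.ncard : ℤ) = Nat.card V - (B i).size := fun i =>
    eq_sub_of_add_eq (by exact_mod_cast (hB.1.1 i).ncard_rootSet_add_size)
  have hsum : ∑ i, ((B i).rootSet.ncard : ℤ) = k * Nat.card V - Nat.card E := by
    simp only [hroot, sum_sub_distrib, ← Nat.cast_sum, hB.sum_size, sum_const, card_univ,
      Fintype.card_fin, nsmul_eq_mul, Nat.cast_mul, Nat.cast_id]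
  have hcount := eq_floor_or_eq_ceil_of_balanced (K := ℝ)
    (a := fun i => ((B i).rootSet.ncard : ℤ)) (fun i j => by
      have := hbal j i
      have := hroot i
      have := hroot j
      omega) i
  rwa [hsum, Fintype.card_fin] at hcount

end MultiDigraph

theorem corollary1p7_general {V E : Type*} [Finite E] (D : MultiDigraph V E) (k : ℕ)
    (hD : (∃ B : Fin k → D.Subdigraph, D.IsBranchingCover B) ∨
      D.maxInDegree ≤ k ∧ D.fractionalArboricity ≤ k) :
    ∃ B : Fin k → D.Subdigraph, D.IsBranchingDecomposition B ∧
      (∀ i, (B i).size = ⌊(Nat.card E : ℝ) / k⌋₊ ∨ (B i).size = ⌈(Nat.card E : ℝ) / k⌉₊) ∧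
      (Finite V → ∀ c : ℤ, c = (k : ℤ) * Nat.card V - Nat.card E → ∀ i,
        ((B i).rootSet.ncard : ℤ) = ⌊(c : ℝ) / k⌋ ∨
          ((B i).rootSet.ncard : ℤ) = ⌈(c : ℝ) / k⌉) := by
  obtain ⟨f, hf⟩ : ∃ f : E → Fin k, D.IsDiforestColoring f := by
    rcases hD with ⟨B, hB⟩ | ⟨hdeg, harb⟩
    · exact hB.exists_isDiforestColoring
    · exact MultiDigraph.exists_isDiforestColoring_of_fractionalArboricity_le hdeg harb
  obtain ⟨g, hg, hbal⟩ := hf.exists_balanced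
  obtain ⟨B, hB, harcs⟩ := hg.exists_isBranchingDecomposition
  have hsize : ∀ i j, (B i).size ≤ (B j).size + 1 := by
    simpa only [MultiDigraph.Subdigraph.size, harcs] using hbal
  refine ⟨B, hB, hB.size_eq_floor_or_ceil hsize, ?_⟩
  rintro _ c rfl
  exact hB.ncard_rootSet_eq_floor_or_ceil hsize

theorem corollary1p7 {V E : Type*} [Finite V] [Finite E] (D : MultiDigraph V E)
    (k : ℕ) (hk : 0 < k) :
    ((∃ B : Fin k → D.Subdigraph, D.IsBranchingCover B) →
      ∃ B : Fin k → D.Subdigraph, D.IsBranchingCover B ∧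
        ∀ i, (B i).size = ⌊(Nat.card E : ℝ) / k⌋₊ ∨ (B i).size = ⌈(Nat.card E : ℝ) / k⌉₊) ∧
    (D.maxInDegree ≤ k → D.fractionalArboricity ≤ k →
      ∀ c : ℤ, c = (k : ℤ) * Nat.card V - Nat.card E →
        ∃ B : Fin k → D.Subdigraph, D.IsBranchingDecomposition B ∧
          ∀ i, ((B i).rootSet.ncard : ℤ) = ⌊(c : ℝ) / k⌋ ∨
            ((B i).rootSet.ncard : ℤ) = ⌈(c : ℝ) / k⌉) := by
  refine ⟨fun hB => ?_, fun hdeg harb c hc => ?_⟩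
  · obtain ⟨B, hB, hsize, -⟩ := corollary1p7_general D k (.inl hB)
    exact ⟨B, hB.1, hsize⟩
  · obtain ⟨B, hB, -, hroot⟩ := corollary1p7_general D k (.inr ⟨hdeg, harb⟩)
    exact ⟨B, hB, hroot ‹_› c hc⟩
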